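/- Let $\mathscr{X}$ be a finite non-empty set, $\mathscr{X}^*=\bigcup_{n\ge 0}\mathscr{X}^n$ the set of finite strings (situations), and $\Omega=\mathscr{X}^{\mathbb{N}}$ the set of paths. For $\omega\in\Omega$ let $\omega^n\in\mathscr{X}^n$ be the string of its first $n$ states; for $s\in\mathscr{X}^*$ of length $n$ let $\Gamma(s)=\{\omega\in\Omega:\omega^n=s\}$. For extended real variables $f,g:\Omega\to\overline{\mathbb{R}}$ write $g\ge_s f$ if $g(\omega)\ge f(\omega)$ for all $\omega\in\Gamma(s)$. An extended real function is bounded below if it is $\ge M$ everywhere for some real $M$. For every $s\in\mathscr{X}^*$ let a local upper expectation $\overline{\mathrm{Q}}_s$ be given, that is, a map from the set of all functions $\mathscr{X}\to\overline{\mathbb{R}}$ to $\overline{\mathbb{R}}$ such that, for all bounded below $f,g:\mathscr{X}\to\overline{\mathbb{R}}$, all real $c$ and all real $\lambda>0$: $\overline{\mathrm{Q}}_s(c)=c$; $\overline{\mathrm{Q}}_s(f+g)\le\overline{\mathrm{Q}}_s(f)+\overline{\mathrm{Q}}_s(g)$; $\overline{\mathrm{Q}}_s(\lambda f)=\lambda\overline{\mathrm{Q}}_s(f)$;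 $f\le g$ implies $\overline{\mathrm{Q}}_s(f)\le\overline{\mathrm{Q}}_s(g)$; and $\lim_n\overline{\mathrm{Q}}_s(f_n)=\overline{\mathrm{Q}}_s(\lim_n f_n)$ for every non-decreasing sequence $(f_n)$ of non-negative functions $\mathscr{X}\to\overline{\mathbb{R}}$. Such a family is called an imprecise probabilities tree. Let $\overline{\mathbb{M}}_{\mathrm b}$ be the set of all bounded below $\mathscr{M}:\mathscr{X}^*\to\overline{\mathbb{R}}$ with $\overline{\mathrm{Q}}_s(x\mapsto\mathscr{M}(sx))\le\mathscr{M}(s)$ for all $s\in\mathscr{X}^*$, and define, for $f:\Omega\to\overline{\mathbb{R}}$ and $s\in\mathscr{X}^*$, $$\overline{\mathrm{E}}_{\mathrm V}(f|s)=\inf\Big\{\mathscr{M}(s):\mathscr{M}\in\overline{\mathbb{M}}_{\mathrm b},\ \liminf_{n\to\infty}\mathscr{M}(\omega^n)\ge f(\omega)\text{ for all }\omega\in\Gamma(s)\Big\}.$$ Call $f:\Omega\to\overline{\mathbb{R}}$ finitary if for some $n\ge 0$ the value $f(\omega)$ depends only on $\omega^n$, and let $\overline{\mathbb{V}}_{b,\lim}$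 be the set of all bounded below $g:\Omega\to\overline{\mathbb{R}}$ that are pointwise limits of sequences of finitary variables. Then for all $f:\Omega\to\overline{\mathbb{R}}$ and $s\in\mathscr{X}^*$, $$\overline{\mathrm{E}}_{\mathrm V}(f|s)=\inf\{\overline{\mathrm{E}}_{\mathrm V}(g|s):g\in\overline{\mathbb{V}}_{b,\lim},\ g\ge_s f\}=\inf\{\overline{\mathrm{E}}_{\mathrm V}(g|s):g\in\overline{\mathbb{V}}_{b,\lim},\ g\ge f\}.$$ Consequently $\overline{\mathrm{E}}_{\mathrm V}$ is uniquely determined by its values on $\overline{\mathbb{V}}_{b,\lim}$: if, for some situation $s$, the upper expectations obtained from two imprecise probabilities trees on $\mathscr{X}$ agree on $\overline{\mathbb{V}}_{b,\lim}$ conditional on $s$, then they agree on all extended real variables on $\Omega$ conditional on $s$. -/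

import Mathlib

open Filter Topology

namespace GameTheoretic

/-- An extended real variable `f` on `Y` is bounded below if `f ≥ M` for some real `M`. -/
def BddBelowVar {Y : Type*} (f : Y → EReal) : Prop :=
  ∃ M : ℝ, ∀ y, (M : EReal) ≤ f y

/-- Upper expectations on the set of all extended real variables on `Y`. Sublinearity, positive
homogeneity, monotonicity and upward continuity are only imposed on variables that are bounded
below; for these, no sum `∞ - ∞` occurs, so the convention for such sums plays no role. -/
structure IsUpperExpectation {Y : Type*} (E : (Y → EReal) → EReal) : Prop where
  const : ∀ c : ℝ, E (fun _ => (c : EReal)) = c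
  add_le : ∀ f g : Y → EReal, BddBelowVar f → BddBelowVar g →
    E (fun y => f y + g y) ≤ E f + E g
  pos_homog : ∀ (r : ℝ) (f : Y → EReal), 0 < r → BddBelowVar f →
    E (fun y => (r : EReal) * f y) = (r : EReal) * E f
  mono : ∀ f g : Y → EReal, BddBelowVar f → BddBelowVar g → (∀ y, f y ≤ g y) → E f ≤ E g
  upward_cont : ∀ (f : ℕ → Y → EReal) (g : Y → EReal),
    (∀ n y, 0 ≤ f n y) → (∀ n y, f n y ≤ f (n + 1) y) →
    (∀ y, Tendsto (fun n => f n y) atTop (𝓝 (g y))) →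
    Tendsto (fun n => E (f n)) atTop (𝓝 (E g))

/-- Situations: finite strings `x₁ ⋯ xₙ` of states (`[]` is the initial situation). -/
abbrev Situation (X : Type*) := List X

/-- Paths: infinite sequences of states; `ω n` is the state at time `n + 1`. -/
abbrev Path (X : Type*) := ℕ → X

variable {X : Type*}

/-- The situation `ωⁿ` formed by the first `n` states of the path `ω`. -/
def Path.initial (ω : Path X) (n : ℕ) : Situation X :=
  List.ofFn (fun i : Fin n => ω i)

/-- The cylinder event `Γ(s)`: all paths that go through the situation `s`. -/
def cylinder (s : Situation X) : Set (Path X) :=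
  {ω | Path.initial ω s.length = s}

/-- An imprecise probabilities tree: a local upper expectation `Q s` on the extended real
variables on the state space, for every situation `s`. -/
def IsImpreciseTree (Q : Situation X → (X → EReal) → EReal) : Prop :=
  ∀ s, IsUpperExpectation (Q s)

/-- Extended real processes `M` with `Q s (M (s ·)) ≤ M s` for every situation `s`. -/
def IsSupermartingale (Q : Situation X → (X → EReal) → EReal) (M : Situation X → EReal) : Prop :=
  ∀ s, Q s (fun x => M (s ++ [x])) ≤ M s

/-- The global variable `liminf M`. -/
noncomputable def liminfProcess (M : Situation X → EReal) (ω : Path X) : EReal :=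
  liminf (fun n => M (Path.initial ω n)) atTop

/-- The global game-theoretic upper expectation of `f` conditional on `s`: the infimum of `M s`
over the bounded below supermartingales `M` with `liminf M ≥ f` on `Γ(s)`. -/
noncomputable def upperE (Q : Situation X → (X → EReal) → EReal)
    (f : Path X → EReal) (s : Situation X) : EReal :=
  sInf {a | ∃ M : Situation X → EReal, IsSupermartingale Q M ∧ BddBelowVar M ∧
    (∀ ω ∈ cylinder s, f ω ≤ liminfProcess M ω) ∧ a = M s}

/-- `f` is `n`-measurable: it is constant on the cylinder events of situations of length `n`. -/
def IsNMeasurable (n : ℕ) (f : Path X → EReal) : Prop :=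
  ∀ ω ω' : Path X, Path.initial ω n = Path.initial ω' n → f ω = f ω'

/-- Finitary (extended real) variables. -/
def IsFinitary (f : Path X → EReal) : Prop :=
  ∃ n : ℕ, IsNMeasurable n f

/-- The set of all bounded below global variables that are pointwise limits of sequences of
finitary variables. -/
def limFinitary (X : Type*) : Set (Path X → EReal) :=
  {g | BddBelowVar g ∧ ∃ u : ℕ → Path X → EReal, (∀ n, IsFinitary (u n)) ∧
    ∀ ω, Tendsto (fun n => u n ω) atTop (𝓝 (g ω))}

end GameTheoretic

open scoped ENNReal NNReal

namespace GameTheoretic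

/-! By monotonicity every admissible `g` bounds `f` from above, so the point is to find, for a
supermartingale M admissible for `f`, a limit variable whose upper expectation hardly exceeds M(s).
If M converged on all paths, its pathwise limit would do: it is the limit of the finitary variables
M(ωⁿ), and M itself bounds its upper expectation. Doob's upcrossing argument forces convergence. Add
to M small stakes in strategies that buy M low and sell it high, one per rational interval. Where M
oscillates, some strategy earns without bound and the total tends to ∞; where M converges, possibly
to ∞, so does the total (`exists_tendsto_add_upcrossSum`). Sublinear local expectations suffice
because the strategies never sell short; upward continuity handles the countable mixture. -/

/-! ### Upper expectations of nonnegative variables -/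

/-- The upper expectation of the nonnegative variable `f` is at most `a`. -/
def UpperLE {Y : Type*} (E : (Y → EReal) → EReal) (f : Y → ℝ≥0∞) (a : ℝ≥0∞) : Prop :=
  E (fun y => (f y : EReal)) ≤ (a : EReal)

section UpperLE

variable {Y : Type*} {E : (Y → EReal) → EReal} {f g : Y → ℝ≥0∞} {a b : ℝ≥0∞}

theorem bddBelowVar_coe_ennreal (f : Y → ℝ≥0∞) : BddBelowVar (fun y => (f y : EReal)) :=
  ⟨0, fun y => by simpa using EReal.coe_ennreal_nonneg (f y)⟩

theorem UpperLE.of_le (hE : IsUpperExpectation E) (hg : UpperLE E g b)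
    (hfg : ∀ y, f y ≤ g y) (hba : b ≤ a) : UpperLE E f a :=
  (hE.mono _ _ (bddBelowVar_coe_ennreal f) (bddBelowVar_coe_ennreal g)
    fun y => EReal.coe_ennreal_le_coe_ennreal_iff.2 (hfg y)).trans
    (hg.trans (EReal.coe_ennreal_le_coe_ennreal_iff.2 hba))

theorem upperLE_const (hE : IsUpperExpectation E) (c : ℝ≥0) : UpperLE E (fun _ => c) c :=
  (hE.const c).le

theorem UpperLE.add (hE : IsUpperExpectation E) (hf : UpperLE E f a) (hg : UpperLE E g b) :
    UpperLE E (fun y => f y + g y) (a + b) := by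
  unfold UpperLE
  simp only [EReal.coe_ennreal_add]
  exact (hE.add_le _ _ (bddBelowVar_coe_ennreal f) (bddBelowVar_coe_ennreal g)).trans
    (add_le_add hf hg)

theorem UpperLE.const_mul (hE : IsUpperExpectation E) (hf : UpperLE E f a) {w : ℝ≥0}
    (hw : 0 < w) : UpperLE E (fun y => w * f y) (w * a) := by
  unfold UpperLE
  simp only [EReal.coe_ennreal_mul]
  refine (hE.pos_homog w _ (by exact_mod_cast hw) (bddBelowVar_coe_ennreal f)).le.trans ?_
  exact mul_le_mul_of_nonneg_left hf (by exact_mod_cast hw.le)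

theorem UpperLE.min_const (hE : IsUpperExpectation E) (hf : UpperLE E f a) (c : ℝ≥0) :
    UpperLE E (fun y => min (f y) c) (min a c) := by
  rcases le_total a c with h | h
  · rw [min_eq_left h]
    exact hf.of_le hE (fun y => min_le_left _ _) le_rfl
  · rw [min_eq_right h]
    exact (upperLE_const hE c).of_le hE (fun y => min_le_right _ _) le_rfl

/-- Finite subadditivity passes to countable sums by upward continuity along the partial sums. -/
theorem UpperLE.tsum (hE : IsUpperExpectation E) {f : ℕ → Y → ℝ≥0∞} {a : ℕ → ℝ≥0∞}
    (h : ∀ i, UpperLE E (f i) (a i)) : UpperLE E (fun y => ∑' i, f i y) (∑' i, a i) := by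
  have hfin : ∀ n, UpperLE E (fun y => ∑ i ∈ Finset.range n, f i y)
      (∑ i ∈ Finset.range n, a i) := by
    intro n
    induction n with
    | zero => simpa using upperLE_const hE 0
    | succ n ih => simpa only [Finset.sum_range_succ] using ih.add hE (h n)
  refine le_of_tendsto (hE.upward_cont (fun n y => ((∑ i ∈ Finset.range n, f i y : ℝ≥0∞) : EReal))
    _ (fun n y => EReal.coe_ennreal_nonneg _) (fun n y => ?_) fun y => ?_)
    (Eventually.of_forall fun n => (hfin n).trans ?_)
  · rw [EReal.coe_ennreal_le_coe_ennreal_iff, Finset.sum_range_succ]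
    exact le_self_add
  · exact EReal.tendsto_coe_ennreal.2 (ENNReal.tendsto_nat_tsum _)
  · exact EReal.coe_ennreal_le_coe_ennreal_iff.2 (ENNReal.sum_le_tsum _)

end UpperLE

/-! ### Upcrossing strategies -/

/-- The next state of the strategy that buys one unit at or below `α` and sells it at or above
`α + γ`, after observing `v`. The state records whether the unit is held, and the number of
sales. -/
noncomputable def upcrossStep (α γ : ℝ≥0) (p : Bool × ℕ) (v : ℝ≥0∞) : Bool × ℕ :=
  if p.1 then (if (α + γ : ℝ≥0∞) ≤ v then (false, p.2 + 1) else p)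
  else (if v ≤ α then (true, p.2) else p)

/-- The state of the upcrossing strategy after the observations `u 1, …, u n`. -/
noncomputable def upcrossState (α γ : ℝ≥0) (u : ℕ → ℝ≥0∞) : ℕ → Bool × ℕ
  | 0 => (false, 0)
  | n + 1 => upcrossStep α γ (upcrossState α γ u n) (u (n + 1))

/-- The part of the capital of the upcrossing strategy that does not stem from earlier sales. -/
noncomputable def upcrossHolding (α γ : ℝ≥0) (h : Bool) (v : ℝ≥0∞) : ℝ≥0∞ :=
  if h then min v (α + γ : ℝ≥0) else α

/-- The capital of the upcrossing strategy in the state `p`, when the observed value is `v`. -/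
noncomputable def upcrossValue (α γ : ℝ≥0) (p : Bool × ℕ) (v : ℝ≥0∞) : ℝ≥0∞ :=
  (p.2 * γ : ℝ≥0) + upcrossHolding α γ p.1 v

theorem upcrossHolding_le (α γ : ℝ≥0) (h : Bool) (v : ℝ≥0∞) :
    upcrossHolding α γ h v ≤ (α + γ : ℝ≥0) := by
  unfold upcrossHolding
  split_ifs
  · exact min_le_right _ _
  · exact_mod_cast le_self_add

/-- A sale turns the capped value α + γ into α plus a gain γ, at no loss; a purchase replaces α by a
value at most α. -/
theorem upcrossValue_step_le (α γ : ℝ≥0) (p : Bool × ℕ) (v : ℝ≥0∞) :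
    upcrossValue α γ (upcrossStep α γ p v) v ≤ upcrossValue α γ p v := by
  obtain ⟨h, U⟩ := p
  cases h
  · by_cases hv : v ≤ α
    · simp only [upcrossStep, upcrossValue, upcrossHolding, hv]
      simpa using add_le_add_right (min_le_left v _ |>.trans hv) _
    · simp [upcrossStep, hv]
  · by_cases hv : (α + γ : ℝ≥0∞) ≤ v
    · simp [upcrossStep, upcrossValue, upcrossHolding, hv, add_mul, add_assoc, add_comm]
    · simp [upcrossStep, hv]

/-- For a fixed state the capital is a constant plus either α or a capped value, so constants,
monotonicity and subadditivity suffice. -/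
theorem UpperLE.upcrossValue {Y : Type*} {E : (Y → EReal) → EReal} (hE : IsUpperExpectation E)
    {f : Y → ℝ≥0∞} {a : ℝ≥0∞} (hf : UpperLE E f a) (α γ : ℝ≥0) (p : Bool × ℕ) :
    UpperLE E (fun y => upcrossValue α γ p (f y)) (upcrossValue α γ p a) := by
  refine (upperLE_const hE _).add hE ?_
  obtain ⟨h, U⟩ := p
  cases h
  · simpa [upcrossHolding] using upperLE_const hE α
  · exact hf.min_const hE (α + γ)

/-- Nonanticipation: the position held before the next observation depends on the past only. -/
theorem upcrossState_congr (α γ : ℝ≥0) {u v : ℕ → ℝ≥0∞} {n : ℕ} (h : ∀ k ≤ n, u k = v k) :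
    upcrossState α γ u n = upcrossState α γ v n := by
  induction n with
  | zero => rfl
  | succ n ih =>
    rw [upcrossState, upcrossState, ih fun k hk => h k (hk.trans n.le_succ), h _ le_rfl]

theorem upcrossState_snd_succ (α γ : ℝ≥0) (u : ℕ → ℝ≥0∞) (n : ℕ) :
    (upcrossState α γ u n).2 ≤ (upcrossState α γ u (n + 1)).2 ∧
      (upcrossState α γ u (n + 1)).2 ≤ (upcrossState α γ u n).2 + 1 := by
  rw [upcrossState, upcrossStep]
  split_ifs <;> simp

theorem monotone_upcrossState_snd (α γ : ℝ≥0) (u : ℕ → ℝ≥0∞) :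
    Monotone fun n => (upcrossState α γ u n).2 :=
  monotone_nat_of_le_succ fun n => (upcrossState_snd_succ α γ u n).1

theorem upcrossState_snd_le (α γ : ℝ≥0) (u : ℕ → ℝ≥0∞) (n : ℕ) :
    (upcrossState α γ u n).2 ≤ n := by
  induction n with
  | zero => exact le_rfl
  | succ n ih => exact (upcrossState_snd_succ α γ u n).2.trans (Nat.succ_le_succ ih)

/-- If `u` converges, then the upcrossing strategy eventually stops trading. -/
theorem exists_eventually_upcrossState_fst_eq (α : ℝ≥0) {γ : ℝ≥0} (hγ : 0 < γ) {u : ℕ → ℝ≥0∞}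
    {l : ℝ≥0∞} (hu : Tendsto u atTop (𝓝 l)) :
    ∃ h, ∀ᶠ n in atTop, (upcrossState α γ u n).1 = h := by
  have hlt : (α : ℝ≥0∞) < α + γ := by
    exact_mod_cast lt_add_of_pos_right α hγ
  obtain ⟨h, hh⟩ : ∃ h, ∀ᶠ n in atTop,
      (upcrossState α γ u n).1 = h → (upcrossState α γ u (n + 1)).1 = h := by
    -- Below α + γ a held unit is eventually never sold; otherwise the limit exceeds α and nothing
    -- is eventually bought. That position is absorbing.
    rcases lt_or_ge l (α + γ) with hl | hl
    · refine ⟨true, ?_⟩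
      filter_upwards [(tendsto_add_atTop_nat 1).eventually (hu.eventually_lt_const hl)] with n hn hs
      simp [upcrossState, upcrossStep, hs, hn.not_ge]
    · refine ⟨false, ?_⟩
      filter_upwards [(tendsto_add_atTop_nat 1).eventually
        (hu.eventually_const_lt (hlt.trans_le hl))] with n hn hs
      simp [upcrossState, upcrossStep, hs, hn.not_ge]
  obtain ⟨N, hN⟩ := eventually_atTop.1 hh
  by_cases hex : ∃ m ≥ N, (upcrossState α γ u m).1 = h
  · obtain ⟨m, hm, hmh⟩ := hex
    refine ⟨h, eventually_atTop.2 ⟨m, fun n hn => ?_⟩⟩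
    induction n, hn using Nat.le_induction with
    | base => exact hmh
    | succ n hn ih => exact hN n (hm.trans hn) ih
  · push Not at hex
    exact ⟨!h, eventually_atTop.2 ⟨N, fun n hn => Bool.eq_not.2 (hex n hn)⟩⟩

/-- If `u` crosses the interval infinitely often, then so does the number of sales. -/
theorem tendsto_upcrossState_snd_atTop {α γ : ℝ≥0} (hγ : 0 < γ) {u : ℕ → ℝ≥0∞}
    (hlow : ∃ᶠ n in atTop, u n ≤ α) (hhigh : ∃ᶠ n in atTop, (α + γ : ℝ≥0∞) ≤ u n) :
    Tendsto (fun n => (upcrossState α γ u n).2) atTop atTop := by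
  have hlt : (α : ℝ≥0∞) < α + γ := by
    exact_mod_cast lt_add_of_pos_right α hγ
  refine tendsto_atTop_atTop_of_monotone (monotone_upcrossState_snd α γ u) fun b => ?_
  -- If sales stalled, the next low value would ensure that a unit is held, and it would then be
  -- held forever, contradicting a later high value.
  have key : ∀ n, ∃ m, (upcrossState α γ u n).2 < (upcrossState α γ u m).2 := by
    intro n
    by_contra! hcon
    have hconst : ∀ m ≥ n, (upcrossState α γ u m).2 = (upcrossState α γ u n).2 := fun m hm =>
      (hcon m).antisymm (monotone_upcrossState_snd α γ u hm)
    have hkeep : ∀ m ≥ n, (upcrossState α γ u m).1 = true →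
        u (m + 1) < α + γ ∧ (upcrossState α γ u (m + 1)).1 = true := by
      intro m hm ht
      have h1 := hconst (m + 1) (hm.trans m.le_succ)
      rw [← hconst m hm, upcrossState, upcrossStep, if_pos ht] at h1
      split_ifs at h1 with h2
      · simp at h1
      · exact ⟨not_le.1 h2, by rw [upcrossState, upcrossStep, if_pos ht, if_neg h2, ht]⟩
    obtain ⟨k, hk, huk⟩ := frequently_atTop.1 hlow (n + 1)
    obtain ⟨m, rfl⟩ : ∃ m, k = m + 1 := ⟨k - 1, by omega⟩
    have ht : (upcrossState α γ u (m + 1)).1 = true := by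
      cases hm : (upcrossState α γ u m).1
      · simp [upcrossState, upcrossStep, hm, huk]
      · exact (hkeep m (by omega) hm).2
    have hall : ∀ j ≥ m + 1, (upcrossState α γ u j).1 = true := by
      intro j hj
      induction j, hj using Nat.le_induction with
      | base => exact ht
      | succ j hj ih => exact (hkeep j (by omega) ih).2
    obtain ⟨j, hj, huj⟩ := frequently_atTop.1 hhigh (m + 2)
    obtain ⟨i, rfl⟩ : ∃ i, j = i + 1 := ⟨j - 1, by omega⟩
    exact (hkeep i (by omega) (hall i (by omega))).1.not_ge huj
  induction b with
  | zero => exact ⟨0, Nat.zero_le _⟩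
  | succ b ih =>
    obtain ⟨n, hn⟩ := ih
    obtain ⟨m, hm⟩ := key n
    exact ⟨m, by omega⟩

/-! ### Countable mixtures of upcrossing strategies -/

/-- The total capital of a weighted family of upcrossing strategies. -/
noncomputable def upcrossSum (w α γ : ℕ → ℝ≥0) (u : ℕ → ℝ≥0∞) (n : ℕ) : ℝ≥0∞ :=
  ∑' i, w i * upcrossValue (α i) (γ i) (upcrossState (α i) (γ i) u n) (u n)

theorem tendsto_tsum_of_dominated {F : ℕ → ℕ → ℝ≥0∞} {f bound : ℕ → ℝ≥0∞}
    (hb : ∑' i, bound i ≠ ∞) (hF : ∀ n i, F n i ≤ bound i)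
    (hlim : ∀ i, Tendsto (fun n => F n i) atTop (𝓝 (f i))) :
    Tendsto (fun n => ∑' i, F n i) atTop (𝓝 (∑' i, f i)) := by
  simp only [← MeasureTheory.lintegral_count] at hb ⊢
  exact MeasureTheory.tendsto_lintegral_of_dominated_convergence bound
    (fun n => measurable_of_countable _) (fun n => Eventually.of_forall (hF n)) hb
    (Eventually.of_forall hlim)

/-- The realized gains increase with time; the remaining holdings converge termwise and are
dominated by the summable `w i * (α i + γ i)`. -/
theorem exists_tendsto_upcrossSum {w α γ : ℕ → ℝ≥0} (hγ : ∀ i, 0 < γ i)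
    (hsum : ∑' i, (w i * (α i + γ i : ℝ≥0) : ℝ≥0∞) ≠ ∞) {u : ℕ → ℝ≥0∞} {l : ℝ≥0∞}
    (hu : Tendsto u atTop (𝓝 l)) : ∃ c, Tendsto (upcrossSum w α γ u) atTop (𝓝 c) := by
  have hR : ∀ i, ∃ c, Tendsto (fun n => w i *
      upcrossHolding (α i) (γ i) (upcrossState (α i) (γ i) u n).1 (u n)) atTop (𝓝 c) := by
    intro i
    obtain ⟨h, hh⟩ := exists_eventually_upcrossState_fst_eq (α i) (hγ i) hu
    refine ⟨w i * upcrossHolding (α i) (γ i) h l,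
      ENNReal.Tendsto.const_mul ?_ (Or.inr ENNReal.coe_ne_top)⟩
    refine Tendsto.congr' (f₁ := fun n => upcrossHolding (α i) (γ i) h (u n)) ?_ ?_
    · filter_upwards [hh] with n hn
      rw [hn]
    · unfold upcrossHolding
      split_ifs
      · exact hu.min tendsto_const_nhds
      · exact tendsto_const_nhds
  choose c hc using hR
  have h1 := tendsto_tsum_of_dominated hsum
    (fun n i => mul_le_mul_right (upcrossHolding_le (α i) (γ i) _ _) _) hc
  have h2 : Monotone fun n => ∑' i, (w i * ((upcrossState (α i) (γ i) u n).2 * γ i : ℝ≥0) : ℝ≥0∞) := by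
    intro m n hmn
    refine ENNReal.tsum_le_tsum fun i => mul_le_mul_right (ENNReal.coe_le_coe.2 ?_) _
    exact mul_le_mul_left (Nat.cast_le.2 (monotone_upcrossState_snd _ _ _ hmn)) _
  refine ⟨_, ((tendsto_atTop_iSup h2).add h1).congr fun n => ?_⟩
  simp only [upcrossSum, upcrossValue, mul_add, ENNReal.tsum_add]

theorem exists_tendsto_add_upcrossSum {w α γ : ℕ → ℝ≥0} (hw : ∀ i, 0 < w i) (hγ : ∀ i, 0 < γ i)
    (hsum : ∑' i, (w i * (α i + γ i : ℝ≥0) : ℝ≥0∞) ≠ ∞)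
    (hdense : ∀ a b : ℝ≥0∞, a < b → ∃ i, a ≤ α i ∧ (α i + γ i : ℝ≥0∞) ≤ b) (u : ℕ → ℝ≥0∞) :
    ∃ c, Tendsto (fun n => u n + upcrossSum w α γ u n) atTop (𝓝 c) := by
  by_cases hu : ∃ l, Tendsto u atTop (𝓝 l)
  · obtain ⟨l, hl⟩ := hu
    obtain ⟨c, hc⟩ := exists_tendsto_upcrossSum hγ hsum hl
    exact ⟨l + c, hl.add hc⟩
  · obtain ⟨a, b, hab, ha, hb⟩ : ∃ a b : ℝ≥0∞, a < b ∧ (∃ᶠ n in atTop, u n < a) ∧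
        ∃ᶠ n in atTop, b < u n := by
      by_contra! hcon
      refine hu (tendsto_of_no_upcrossings dense_univ fun a _ b _ hab h => ?_)
      exact h.2 ((hcon a b hab h.1).mono fun n hn => hn.not_gt)
    obtain ⟨i, hai, hib⟩ := hdense a b hab
    have hU := tendsto_upcrossState_snd_atTop (hγ i) (ha.mono fun n hn => hn.le.trans hai)
      (hb.mono fun n hn => hib.trans hn.le)
    have h1 : Tendsto (fun n => ((w i * γ i : ℝ≥0) : ℝ≥0∞) * ((upcrossState (α i) (γ i) u n).2 : ℝ≥0∞))
        atTop (𝓝 ∞) := by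
      have := ENNReal.Tendsto.const_mul (a := ((w i * γ i : ℝ≥0) : ℝ≥0∞))
        (ENNReal.tendsto_nat_nhds_top.comp hU) (Or.inr ENNReal.coe_ne_top)
      rwa [ENNReal.mul_top (by simpa using ⟨(hw i).ne', (hγ i).ne'⟩)] at this
    refine ⟨∞, tendsto_nhds_top_mono' h1 fun n => ?_⟩
    calc ((w i * γ i : ℝ≥0) : ℝ≥0∞) * ((upcrossState (α i) (γ i) u n).2 : ℝ≥0∞)
        = w i * ((upcrossState (α i) (γ i) u n).2 * γ i : ℝ≥0) := by push_cast; ring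
      _ ≤ w i * upcrossValue (α i) (γ i) (upcrossState (α i) (γ i) u n) (u n) :=
          mul_le_mul_right le_self_add _
      _ ≤ upcrossSum w α γ u n := ENNReal.le_tsum i
      _ ≤ u n + upcrossSum w α γ u n := le_add_self

/-- At most `n` sales occur by time `n`. This a priori bound controls the extra capital at `s`
without restarting the strategies there. -/
theorem upcrossSum_le (w α γ : ℕ → ℝ≥0) (u : ℕ → ℝ≥0∞) (n : ℕ) :
    upcrossSum w α γ u n ≤ (n + 1) * ∑' i, (w i * (α i + γ i : ℝ≥0) : ℝ≥0∞) := by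
  rw [← ENNReal.tsum_mul_left]
  refine ENNReal.tsum_le_tsum fun i => ?_
  rw [mul_left_comm]
  refine mul_le_mul_right ?_ _
  rw [add_mul, one_mul]
  refine add_le_add ?_ (upcrossHolding_le _ _ _ _)
  push_cast
  gcongr
  · exact upcrossState_snd_le _ _ _ _
  · exact le_add_self

/-- Intervals that separate all pairs of extended nonnegative reals, with summable weights. -/
theorem exists_upcross_family {ε : ℝ≥0∞} (hε : ε ≠ 0) : ∃ w α γ : ℕ → ℝ≥0, (∀ i, 0 < w i) ∧
    (∀ i, 0 < γ i) ∧ ∑' i, (w i * (α i + γ i : ℝ≥0) : ℝ≥0∞) ≤ ε ∧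
    ∀ a b : ℝ≥0∞, a < b → ∃ i, a ≤ α i ∧ (α i + γ i : ℝ≥0∞) ≤ b := by
  have : Nonempty {p : ℚ × ℚ // 0 < p.2} := ⟨⟨(0, 1), one_pos⟩⟩
  obtain ⟨e, he⟩ := exists_surjective_nat {p : ℚ × ℚ // 0 < p.2}
  obtain ⟨δ, hδ, hδε⟩ := ENNReal.exists_pos_sum_of_countable hε ℕ
  set α : ℕ → ℝ≥0 := fun i => Real.toNNReal (e i).1.1
  set γ : ℕ → ℝ≥0 := fun i => Real.toNNReal (e i).1.2
  have hγ : ∀ i, 0 < γ i := fun i => Real.toNNReal_pos.2 (by exact_mod_cast (e i).2)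
  have hpos : ∀ i, 0 < α i + γ i := fun i => add_pos_of_nonneg_of_pos (zero_le) (hγ i)
  -- The weights make the `i`-th term of the sum exactly `δ i`.
  refine ⟨fun i => δ i / (α i + γ i), α, γ, fun i => div_pos (hδ i) (hpos i), hγ, ?_, ?_⟩
  · refine le_of_eq_of_le (tsum_congr fun i => ?_) hδε.le
    rw [← ENNReal.coe_mul, div_mul_cancel₀ _ (hpos i).ne']
  · intro a b hab
    obtain ⟨p, hp, hap, hpb⟩ := ENNReal.lt_iff_exists_rat_btwn.1 hab
    obtain ⟨q, hq, hpq, hqb⟩ := ENNReal.lt_iff_exists_rat_btwn.1 hpb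
    have hlt : p < q := by
      have := (Real.toNNReal_lt_toNNReal_iff_of_nonneg (by exact_mod_cast hp)).1
        (ENNReal.coe_lt_coe.1 hpq)
      exact_mod_cast this
    obtain ⟨i, hi⟩ := he ⟨(p, q - p), sub_pos.2 hlt⟩
    refine ⟨i, ?_, ?_⟩
    · simpa [α, hi] using hap.le
    · refine le_trans (le_of_eq ?_) hqb.le
      rw [← ENNReal.coe_add, ENNReal.coe_inj]
      simp only [α, γ, hi]
      rw [← Real.toNNReal_add (by exact_mod_cast hp) (by exact_mod_cast (sub_pos.2 hlt).le)]
      push_cast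
      ring_nf


variable {X : Type*} {Q : Situation X → (X → EReal) → EReal}

/-! ### Paths and situations -/

@[simp]
theorem length_initial (ω : Path X) (n : ℕ) : (Path.initial ω n).length = n := by
  simp [Path.initial]

theorem take_initial (ω : Path X) {k n : ℕ} (h : k ≤ n) :
    (Path.initial ω n).take k = Path.initial ω k := by
  refine List.ext_getElem (by simp [h]) fun i h₁ h₂ => ?_
  simp [Path.initial]

theorem initial_eq_of_le {ω ω' : Path X} {k n : ℕ} (h : k ≤ n)
    (hn : Path.initial ω n = Path.initial ω' n) : Path.initial ω k = Path.initial ω' k := by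
  rw [← take_initial ω h, hn, take_initial ω' h]

/-! ### Convergent supermartingales -/

/-- The process `N` together with a weighted family of upcrossing strategies that trade in it. -/
noncomputable def upcrossProcess (w α γ : ℕ → ℝ≥0) (N : Situation X → ℝ≥0∞)
    (t : Situation X) : ℝ≥0∞ :=
  N t + upcrossSum w α γ (fun k => N (t.take k)) t.length

theorem upcrossProcess_initial (w α γ : ℕ → ℝ≥0) (N : Situation X → ℝ≥0∞) (ω : Path X) (n : ℕ) :
    upcrossProcess w α γ N (Path.initial ω n) = N (Path.initial ω n) +
      upcrossSum w α γ (fun k => N (Path.initial ω k)) n := by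
  simp only [upcrossProcess, upcrossSum, length_initial, take_initial ω le_rfl]
  congr 2 with i
  rw [upcrossState_congr (v := fun k => N (Path.initial ω k)) _ _
    fun k hk => by rw [take_initial ω hk]]

theorem upperLE_upcrossProcess (hQ : IsImpreciseTree Q) {w : ℕ → ℝ≥0} (α γ : ℕ → ℝ≥0)
    (hw : ∀ i, 0 < w i) {N : Situation X → ℝ≥0∞}
    (hN : ∀ t, UpperLE (Q t) (fun x => N (t ++ [x])) (N t)) (t : Situation X) :
    UpperLE (Q t) (fun x => upcrossProcess w α γ N (t ++ [x])) (upcrossProcess w α γ N t) := by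
  have hE := hQ t
  refine UpperLE.of_le hE ((hN t).add hE (UpperLE.tsum hE fun i =>
    ((hN t).upcrossValue hE (α i) (γ i)
      (upcrossState (α i) (γ i) (fun k => N (t.take k)) t.length)).const_mul hE (hw i)))
    (fun x => ?_) (le_of_eq ?_)
  · refine add_le_add le_rfl (ENNReal.tsum_le_tsum fun i => mul_le_mul_right ?_ _)
    have hst : upcrossState (α i) (γ i) (fun k => N ((t ++ [x]).take k)) t.length =
        upcrossState (α i) (γ i) (fun k => N (t.take k)) t.length :=
      upcrossState_congr _ _ fun k hk => by rw [List.take_append_of_le_length hk]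
    have htake : (t ++ [x]).take (t.length + 1) = t ++ [x] := by
      rw [List.take_of_length_le (by simp)]
    simp only [List.length_append, List.length_singleton, upcrossState, hst, htake]
    exact upcrossValue_step_le _ _ _ _
  · simp only [upcrossProcess, upcrossSum, List.take_length]

theorem IsSupermartingale.add_const (hQ : IsImpreciseTree Q) {M : Situation X → EReal}
    (hM : IsSupermartingale Q M) (hb : BddBelowVar M) (c : ℝ) :
    IsSupermartingale Q fun t => M t + c := by
  intro t
  obtain ⟨m, hm⟩ := hb
  refine ((hQ t).add_le _ _ ⟨m, fun x => hm _⟩ ⟨c, fun _ => le_rfl⟩).trans ?_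
  rw [(hQ t).const]
  exact add_le_add (hM t) le_rfl

theorem BddBelowVar.add_const {Y : Type*} {f : Y → EReal} (hf : BddBelowVar f) (c : ℝ) :
    BddBelowVar fun y => f y + c := by
  obtain ⟨m, hm⟩ := hf
  exact ⟨m + c, fun y => by rw [EReal.coe_add]; exact add_le_add (hm y) le_rfl⟩

theorem add_coe_add_coe_neg (x : EReal) (c : ℝ) : x + (c : EReal) + ((-c : ℝ) : EReal) = x := by
  rw [add_assoc, ← EReal.coe_add, add_neg_cancel, EReal.coe_zero, add_zero]

/-- Every bounded below supermartingale is dominated by one that converges on all paths and is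
hardly larger at `s`. -/
theorem IsSupermartingale.exists_tendsto (hQ : IsImpreciseTree Q) {M : Situation X → EReal}
    (hM : IsSupermartingale Q M) (hb : BddBelowVar M) (s : Situation X) {ε : ℝ≥0} (hε : 0 < ε) :
    ∃ T : Situation X → EReal, IsSupermartingale Q T ∧ BddBelowVar T ∧ (∀ t, M t ≤ T t) ∧
      T s ≤ M s + ε ∧ ∀ ω, ∃ c, Tendsto (fun n => T (Path.initial ω n)) atTop (𝓝 c) := by
  obtain ⟨m, hm⟩ := id hb
  have h0 : ∀ t, 0 ≤ M t + ((-m : ℝ) : EReal) := fun t => by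
    refine le_of_eq_of_le ?_ (add_le_add (hm t) le_rfl)
    rw [← EReal.coe_add, add_neg_cancel, EReal.coe_zero]
  -- Shifting by the lower bound allows work in `ℝ≥0∞`, where sums need no convention.
  set N : Situation X → ℝ≥0∞ := fun t => (M t + ((-m : ℝ) : EReal)).toENNReal with hN_def
  have hNM : ∀ t, (N t : EReal) = M t + ((-m : ℝ) : EReal) := fun t => EReal.coe_toENNReal (h0 t)
  have hN : ∀ t, UpperLE (Q t) (fun x => N (t ++ [x])) (N t) := fun t => by
    unfold UpperLE
    simp only [hNM]
    exact hM.add_const hQ hb (-m) t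
  have hδ : (ε : ℝ≥0∞) / (s.length + 1) ≠ 0 :=
    (ENNReal.div_pos (by exact_mod_cast hε.ne') (by finiteness)).ne'
  obtain ⟨w, α, γ, hw, hγ, hsum, hdense⟩ := exists_upcross_family hδ
  have hfin : (ε : ℝ≥0∞) / (s.length + 1) ≠ ∞ := by finiteness
  have hback : ∀ t, M t = (N t : EReal) + (m : EReal) := fun t => by
    have := add_coe_add_coe_neg (M t) (-m)
    rw [neg_neg, ← hNM] at this
    exact this.symm
  have hTb := bddBelowVar_coe_ennreal (upcrossProcess w α γ N)
  have hT : IsSupermartingale Q fun t => (upcrossProcess w α γ N t : EReal) :=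
    upperLE_upcrossProcess hQ α γ hw hN
  refine ⟨fun t => (upcrossProcess w α γ N t : EReal) + (m : EReal), hT.add_const hQ hTb m,
    hTb.add_const m, fun t => ?_, ?_, fun ω => ?_⟩
  · rw [hback t]
    exact add_le_add (EReal.coe_ennreal_le_coe_ennreal_iff.2 le_self_add) le_rfl
  · rw [hback s, add_right_comm]
    refine add_le_add ?_ le_rfl
    have : upcrossProcess w α γ N s ≤ N s + ε := by
      refine add_le_add le_rfl ((upcrossSum_le w α γ _ _).trans ?_)
      refine (mul_le_mul_right hsum _).trans ENNReal.mul_div_le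
    exact (EReal.coe_ennreal_le_coe_ennreal_iff.2 this).trans
      (EReal.coe_ennreal_add _ _).le
  · obtain ⟨c, hc⟩ := exists_tendsto_add_upcrossSum hw hγ (ne_top_of_le_ne_top hfin hsum) hdense
      fun k => N (Path.initial ω k)
    refine ⟨(c : EReal) + (m : EReal), ?_⟩
    simp only [upcrossProcess_initial]
    exact (EReal.continuousAt_add (p := ((c : EReal), (m : EReal))) (Or.inr (EReal.coe_ne_bot m))
      (Or.inr (EReal.coe_ne_top m))).tendsto.comp
      ((EReal.tendsto_coe_ennreal.2 hc).prodMk_nhds tendsto_const_nhds)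

/-! ### Approximation by limits of finitary variables -/

theorem isFinitary_initial (T : Situation X → EReal) (n : ℕ) :
    IsFinitary fun ω => T (Path.initial ω n) :=
  ⟨n, fun ω ω' h => by simp only [h]⟩

open Classical in
theorem IsFinitary.ite_cylinder {f g : Path X → EReal} (hf : IsFinitary f) (hg : IsFinitary g)
    (s : Situation X) : IsFinitary fun ω => if ω ∈ cylinder s then f ω else g ω := by
  obtain ⟨n, hn⟩ := hf
  obtain ⟨k, hk⟩ := hg
  refine ⟨max (max n k) s.length, fun ω ω' h => ?_⟩
  have hs : ω ∈ cylinder s ↔ ω' ∈ cylinder s := by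
    simp only [cylinder, Set.mem_ofPred_eq, initial_eq_of_le (le_max_right _ _) h]
  simp only [hs, hn ω ω' (initial_eq_of_le ((le_max_left _ _).trans (le_max_left _ _)) h),
    hk ω ω' (initial_eq_of_le ((le_max_right _ _).trans (le_max_left _ _)) h)]

theorem upperE_mono (Q : Situation X → (X → EReal) → EReal) {f g : Path X → EReal}
    {s : Situation X} (h : ∀ ω ∈ cylinder s, f ω ≤ g ω) : upperE Q f s ≤ upperE Q g s := by
  refine sInf_le_sInf ?_
  rintro a ⟨M, hM, hb, hg, rfl⟩
  exact ⟨M, hM, hb, fun ω hω => (h ω hω).trans (hg ω hω), rfl⟩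

open Classical in
theorem exists_limFinitary_upperE_le (hQ : IsImpreciseTree Q) {M : Situation X → EReal}
    (hM : IsSupermartingale Q M) (hb : BddBelowVar M) {s : Situation X} {f : Path X → EReal}
    (hf : ∀ ω ∈ cylinder s, f ω ≤ liminfProcess M ω) {ε : ℝ≥0} (hε : 0 < ε) :
    ∃ g ∈ limFinitary X, (∀ ω, f ω ≤ g ω) ∧ upperE Q g s ≤ M s + ε := by
  obtain ⟨T, hT, hTb, hMT, hTs, hlim⟩ := hM.exists_tendsto hQ hb s hε
  choose c hc using hlim
  -- The value `⊤` off `Γ(s)` gives domination of `f` everywhere and does not affect the expectation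
  -- conditional on `s`.
  refine ⟨fun ω => if ω ∈ cylinder s then c ω else ⊤, ⟨?_, fun n ω =>
    if ω ∈ cylinder s then T (Path.initial ω n) else ⊤, fun n => ?_, fun ω => ?_⟩, fun ω => ?_, ?_⟩
  · obtain ⟨m, hm⟩ := hTb
    refine ⟨m, fun ω => ?_⟩
    beta_reduce
    split_ifs
    · exact ge_of_tendsto' (hc ω) fun n => hm _
    · exact le_top
  · exact (isFinitary_initial T n).ite_cylinder (g := fun _ => ⊤) ⟨0, fun _ _ _ => rfl⟩ s
  · beta_reduce
    split_ifs
    · exact hc ω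
    · exact tendsto_const_nhds
  · beta_reduce
    split_ifs with hω
    · refine (hf ω hω).trans ?_
      rw [← (hc ω).liminf_eq]
      exact liminf_le_liminf (Eventually.of_forall fun n => hMT _)
    · exact le_top
  · refine le_trans (b := T s) ?_ hTs
    refine sInf_le ⟨T, hT, hTb, fun ω hω => ?_, rfl⟩
    simp only [if_pos hω]
    exact (hc ω).liminf_eq.ge

theorem sInf_limFinitary_le_upperE (hQ : IsImpreciseTree Q) (f : Path X → EReal)
    (s : Situation X) :
    sInf {a | ∃ g ∈ limFinitary X, (∀ ω, f ω ≤ g ω) ∧ a = upperE Q g s} ≤ upperE Q f s := by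
  refine le_sInf ?_
  rintro a ⟨M, hM, hb, hf, rfl⟩
  refine EReal.le_of_forall_lt_iff_le.1 fun z hz => ?_
  -- An intermediate real `y` provides a real `ε = z - y` with `M s + ε ≤ z`, avoiding subtraction
  -- of `M s`.
  obtain ⟨y, hy, hyz⟩ := EReal.lt_iff_exists_real_btwn.1 hz
  have hyz' : y < z := EReal.coe_lt_coe_iff.1 hyz
  obtain ⟨g, hg, hfg, hle⟩ := exists_limFinitary_upperE_le hQ hM hb hf
    (ε := ⟨z - y, sub_nonneg.2 hyz'.le⟩) (sub_pos.2 hyz')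
  refine le_trans (b := upperE Q g s) (sInf_le ?_) (hle.trans ((add_le_add hy.le le_rfl).trans (le_of_eq ?_)))
  · exact ⟨g, hg, hfg, rfl⟩
  change (y : EReal) + ((z - y : ℝ) : EReal) = z
  rw [← EReal.coe_add, add_sub_cancel]

theorem upperE_eq_sInf_limFinitary (hQ : IsImpreciseTree Q) (f : Path X → EReal)
    (s : Situation X) :
    upperE Q f s = sInf {a | ∃ g ∈ limFinitary X, (∀ ω ∈ cylinder s, f ω ≤ g ω) ∧
      a = upperE Q g s} ∧
    upperE Q f s = sInf {a | ∃ g ∈ limFinitary X, (∀ ω, f ω ≤ g ω) ∧ a = upperE Q g s} := by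
  have h1 : upperE Q f s ≤ sInf {a | ∃ g ∈ limFinitary X, (∀ ω ∈ cylinder s, f ω ≤ g ω) ∧
      a = upperE Q g s} := by
    refine le_sInf ?_
    rintro a ⟨g, -, hfg, rfl⟩
    exact upperE_mono Q hfg
  have h2 : sInf {a | ∃ g ∈ limFinitary X, (∀ ω ∈ cylinder s, f ω ≤ g ω) ∧ a = upperE Q g s} ≤
      sInf {a | ∃ g ∈ limFinitary X, (∀ ω, f ω ≤ g ω) ∧ a = upperE Q g s} := by
    refine sInf_le_sInf ?_
    rintro a ⟨g, hg, hfg, rfl⟩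
    exact ⟨g, hg, fun ω _ => hfg ω, rfl⟩
  have h3 := sInf_limFinitary_le_upperE hQ f s
  exact ⟨h1.antisymm (h2.trans h3), (h1.trans h2).antisymm h3⟩

end GameTheoretic

theorem mainTheorem4 {X : Type*} [Finite X] [Nonempty X]
    (Q : GameTheoretic.Situation X → (X → EReal) → EReal)
    (hQ : GameTheoretic.IsImpreciseTree Q) (s : GameTheoretic.Situation X) :
    (∀ f : GameTheoretic.Path X → EReal,
      GameTheoretic.upperE Q f s =
        sInf {a | ∃ g ∈ GameTheoretic.limFinitary X,
          (∀ ω ∈ GameTheoretic.cylinder s, f ω ≤ g ω) ∧ a = GameTheoretic.upperE Q g s} ∧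
      GameTheoretic.upperE Q f s =
        sInf {a | ∃ g ∈ GameTheoretic.limFinitary X,
          (∀ ω, f ω ≤ g ω) ∧ a = GameTheoretic.upperE Q g s}) ∧
    (∀ Q' : GameTheoretic.Situation X → (X → EReal) → EReal,
      GameTheoretic.IsImpreciseTree Q' →
      (∀ g ∈ GameTheoretic.limFinitary X,
        GameTheoretic.upperE Q' g s = GameTheoretic.upperE Q g s) →
      ∀ f : GameTheoretic.Path X → EReal,
        GameTheoretic.upperE Q' f s = GameTheoretic.upperE Q f s) := by
  refine ⟨fun f => GameTheoretic.upperE_eq_sInf_limFinitary hQ f s, fun Q' hQ' hagree f => ?_⟩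
  rw [(GameTheoretic.upperE_eq_sInf_limFinitary hQ' f s).2,
    (GameTheoretic.upperE_eq_sInf_limFinitary hQ f s).2]
  congr 1 with a
  exact exists_congr fun g => and_congr_right fun hg => by rw [hagree g hg]
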